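/- For a positive integer $r$ let $f_r=\prod_{m\ge1}(1-q^{rm})$, as a formal power series in $q$. For a positive integer $\ell$, let $p_{1,\ell}(n)$ be the number of 2-color partitions of $n$ in which one of the colors appears only in parts that are multiples of $\ell$, so that $\sum_{n\ge0}p_{1,\ell}(n)q^n=\frac1{f_1f_\ell}$. Let $M=(m_{i,j})_{i,j\ge1}$ be the infinite integer matrix whose first five rows are \[\begin{pmatrix} 5&0&0&0&0&0&\dots\\ 2\cdot5&5^3&0&0&0&0&\dots\\ 9&3\cdot5^3&5^5&0&0&0&\dots\\ 4&22\cdot5^2&4\cdot5^5&5^7&0&0&\dots\\ 1&4\cdot5^3&8\cdot5^5&5^8&5^9&0&\dots \end{pmatrix}\] and for which, for $i\ge6$, $m_{i,1}=0$ and, for $j\ge2$, \[m_{i,j}=25m_{i-1,j-1}+25m_{i-2,j-1}+15m_{i-3,j-1}+5m_{i-4,j-1}+m_{i-5,j-1}.\] Define the vectors $\mathbf x_k=(x_{k,1},x_{k,2},\dots)$, $k\ge1$, by $\mathbf x_1=(5,0,0,\dots)$ and, for $k,i\ge1$, \[x_{k+1,i}=\begin{cases}\sum_{j\ge1}x_{k,j}\,m_{6j,j+i}&\text{if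 }k\text{ is odd},\\[2pt] \sum_{j\ge1}x_{k,j}\,m_{6j+1,j+i}&\text{if }k\text{ is even}.\end{cases}\] For $k\ge1$ define the coefficients $y^{(2k-1)}_{\beta,j}$ ($\beta,j\ge1$) by \[y^{(2k-1)}_{1,j}=x_{2k-1,j},\qquad y^{(2k-1)}_{\beta+1,j}=\sum_{i\ge1}y^{(2k-1)}_{\beta,i}\,m_{6i+1,j+i}.\] (All these sums have only finitely many nonzero terms.) **Theorem.** For all integers $k\ge1$ and $\beta\ge0$, \[\sum_{n\ge0}p_{1,5^{2k-1}}\!\left(5^{2k+\beta-1}n+\frac{18\cdot5^{2k+\beta-1}+5^{2k-1}+1}{24}\right)q^n=\sum_{i\ge1}y^{(2k-1)}_{\beta+1,i}\,q^{i-1}\,\frac{f_5^{6i-1}}{f_1^{6i+1}}.\] -/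

import Mathlib

open scoped PowerSeries.WithPiTopology

namespace TwoColor

/-- `f_r = ∏_{m ≥ 1} (1 - q^{r m})` as a formal power series in `q`; the infinite product is taken
in the topology of coefficientwise convergence. -/
noncomputable def f (r : ℕ) : PowerSeries ℚ :=
  ∏' m : ℕ, (1 - (PowerSeries.X : PowerSeries ℚ) ^ (r * (m + 1)))

/-- The infinite product defining `f_r` converges for `r ≥ 1`. -/
theorem multipliable_f {r : ℕ} (hr : 1 ≤ r) :
    Multipliable fun m : ℕ => 1 - (PowerSeries.X : PowerSeries ℚ) ^ (r * (m + 1)) := by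
  simp_rw [sub_eq_add_neg]
  refine PowerSeries.WithPiTopology.multipliable_one_add_of_tendsto_order_atTop_nhds_top ℚ ?_
  refine ENat.tendsto_nhds_top_iff_natCast_lt.mpr fun n => Filter.eventually_atTop.mpr ⟨n, ?_⟩
  intro m hm
  rw [PowerSeries.order_neg, PowerSeries.order_X_pow]
  have : n < r * (m + 1) := by nlinarith
  exact_mod_cast this

/-- `f_r` has constant coefficient `1` for `r ≥ 1`, so that its powers are invertible
power series. -/
theorem constantCoeff_f {r : ℕ} (hr : 1 ≤ r) : PowerSeries.constantCoeff (f r) = 1 := by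
  have h := (multipliable_f hr).hasProd.map (PowerSeries.constantCoeff (R := ℚ))
    (PowerSeries.WithPiTopology.continuous_constantCoeff ℚ)
  have h2 : (PowerSeries.constantCoeff (R := ℚ)) ∘
      (fun m : ℕ => 1 - (PowerSeries.X : PowerSeries ℚ) ^ (r * (m + 1))) = fun _ => 1 := by
    funext m
    have : r * (m + 1) ≠ 0 := by positivity
    simp
    omega
  rw [h2] at h
  exact h.unique hasProd_one

/-- `p_{1,l}(n)`: the number of 2-color partitions of `n` in which one of the colors appears only
in parts that are multiples of `l`. Such a partition is a pair consisting of a partition of some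
`a` (the parts of the unrestricted color) and a partition of some `b` all of whose parts are
multiples of `l` (the parts of the other color), where `a + b = n`. -/
def p1 (l n : ℕ) : ℕ :=
  ∑ ab ∈ Finset.HasAntidiagonal.antidiagonal n,
    Fintype.card (Nat.Partition ab.1) * (Nat.Partition.restricted ab.2 (fun c => l ∣ c)).card

/-- The entries `m_{i,j}` (`i, j ≥ 1`) of the infinite matrix `M`: its first five rows are given
explicitly, and for `i ≥ 6` one has `m_{i,1} = 0` and, for `j ≥ 2`, `m_{i,j}` is
`25 m_{i-1,j-1} + 25 m_{i-2,j-1} + 15 m_{i-3,j-1} + 5 m_{i-4,j-1} + m_{i-5,j-1}`.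
Row and column `0` are not part of `M`; they are filled with `0`. -/
def m : ℕ → ℕ → ℤ
  | _, 0 => 0
  | 0, _ => 0
  | 1, 1 => 5
  | 2, 1 => 2 * 5
  | 2, 2 => 5 ^ 3
  | 3, 1 => 9
  | 3, 2 => 3 * 5 ^ 3
  | 3, 3 => 5 ^ 5
  | 4, 1 => 4
  | 4, 2 => 22 * 5 ^ 2
  | 4, 3 => 4 * 5 ^ 5
  | 4, 4 => 5 ^ 7
  | 5, 1 => 1
  | 5, 2 => 4 * 5 ^ 3
  | 5, 3 => 8 * 5 ^ 5
  | 5, 4 => 5 ^ 8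
  | 5, 5 => 5 ^ 9
  | i + 6, j + 2 =>
      25 * m (i + 5) (j + 1) + 25 * m (i + 4) (j + 1) + 15 * m (i + 3) (j + 1)
        + 5 * m (i + 2) (j + 1) + m (i + 1) (j + 1)
  | _, _ => 0

/-- `m_{i,j} = 0` for `i > 5 j`. -/
theorem m_eq_zero (j : ℕ) : ∀ i, 5 * j < i → m i j = 0 := by
  induction j with
  | zero => intro i _; simp [m]
  | succ j ih =>
    intro i hi
    obtain ⟨i, rfl⟩ : ∃ t, i = t + 6 := ⟨i - 6, by omega⟩
    cases j with
    | zero => simp [m]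
    | succ j =>
      rw [m, ih _ (by omega), ih _ (by omega), ih _ (by omega), ih _ (by omega), ih _ (by omega)]
      simp

/-- The sums over `i ≥ 1` below have only finitely many nonzero terms, whatever the vector `v`. -/
theorem finite_support (v : ℕ → ℤ) (a j : ℕ) :
    (Function.support fun i : ℕ+ => v i * m (6 * i + a) (i + j)).Finite := by
  refine Set.Finite.subset (Set.Finite.preimage PNat.coe_injective.injOn
    (Set.finite_Iic (5 * j))) ?_
  intro i hi
  simp only [Set.mem_preimage, Set.mem_Iic]
  by_contra h
  exact hi (by simp [m_eq_zero ((i : ℕ) + j) (6 * i + a) (by omega)])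

/-- The vectors `x_k = (x_{k,1}, x_{k,2}, …)`, `k ≥ 1`: `x_1 = (5, 0, 0, …)`, and `x_{k+1,i}` is
`∑_{j ≥ 1} x_{k,j} m_{6j,j+i}` for odd `k` and `∑_{j ≥ 1} x_{k,j} m_{6j+1,j+i}` for even `k`.
The value at `k = 0` is not used. -/
noncomputable def x : ℕ → ℕ → ℤ
  | 0, _ => 0
  | 1, i => if i = 1 then 5 else 0
  | k + 2, i =>
      if Odd (k + 1) then ∑ᶠ j : ℕ+, x (k + 1) j * m (6 * j) (j + i)
      else ∑ᶠ j : ℕ+, x (k + 1) j * m (6 * j + 1) (j + i)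

/-- The vectors `y^{(2k-1)}_b = (y^{(2k-1)}_{b,1}, y^{(2k-1)}_{b,2}, …)`, `b ≥ 1`, written
`y k b j`: `y^{(2k-1)}_{1,j} = x_{2k-1,j}` and
`y^{(2k-1)}_{b+1,j} = ∑_{i ≥ 1} y^{(2k-1)}_{b,i} m_{6i+1,j+i}`.
The value at `b = 0` is not used. -/
noncomputable def y (k : ℕ) : ℕ → ℕ → ℤ
  | 0, _ => 0
  | 1, j => x (2 * k - 1) j
  | b + 2, j => ∑ᶠ i : ℕ+, y k (b + 1) i * m (6 * i + 1) (j + i)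

/-- The division by `24` in the arithmetic progressions is exact. -/
theorem dvd_offset (k b : ℕ) (hk : 1 ≤ k) :
    24 ∣ 18 * 5 ^ (2 * k + b - 1) + 5 ^ (2 * k - 1) + 1 := by
  obtain ⟨k, rfl⟩ : ∃ t, k = t + 1 := ⟨k - 1, by omega⟩
  have h1 : 2 * (k + 1) - 1 = 2 * k + 1 := by omega
  have h2 : 2 * (k + 1) + b - 1 = 2 * k + 1 + b := by omega
  rw [h1, h2, pow_add _ _ b, pow_succ, pow_mul]
  have e (n : ℕ) : (5 ^ 2) ^ n % 24 = 1 := by simp [Nat.pow_mod]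
  have hb : 5 ^ b % 4 = 1 := by simp [Nat.pow_mod]
  have := e k
  generalize (5 ^ 2) ^ k = u at *
  generalize 5 ^ b = w at *
  obtain ⟨s, rfl⟩ : ∃ s, u = 24 * s + 1 := ⟨u / 24, by omega⟩
  obtain ⟨t, rfl⟩ : ∃ t, w = 4 * t + 1 := ⟨w / 4, by omega⟩
  exact ⟨18 * 5 * s * (4 * t + 1) + 15 * t + 5 * s + 4, by ring⟩

end TwoColor

/-!
Write `U_5` for the operator `∑ a(n) q^n ↦ ∑ a(5n) q^n`; it is linear over series in `q^5`.
The theorem follows from the action of `U_5` on the powers of `t = q f_25 / f_1`: with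
`T = q f_5^6 / f_1^6` one has `U_5(t^i) = ∑_j m_{i,j} T^j` (`progression_hauptmodul25_pow`).
Each series `q^a f_5^c / f_1^e` in the statement becomes, after a shift by `q` or `q^2`, the power
`t^e` times a series in `q^5`, so passing from one arithmetic progression to the next multiplies
the coefficient vector by a shifted matrix `m` (`progression_step`). The induction starts from `∑
p(5n+4) q^n = 5 f_5^5 / f_1^6`, which is the case `i = 1`. The second factor `1 / f_l` of the
generating function is a series in `q^l`, hence passes through the extraction of the exponents in
a residue class modulo `l = 5^(2k-1)` and becomes `1 / f_1` (`exists_progression_p1`).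

The formula for `U_5(t^i)` rests on the modular equation
`t^5 = T(q^5) (1 + 5t + 15t^2 + 25t^3 + 25t^4)` (`modular_equation`), which gives the recursion
for `m`, and on the values for `i ≤ 4`, which are read off from the same equation and the
`5`-dissection of `f_1`.

The dissection has the form `f_1 = U(q^5) - q f_25 - q^2 V(q^5)` with `U V = f_5^2`
(`exists_dissection`). It is obtained from the pentagonal number theorem by sorting the terms
`(-1)^k q^{k(3k-1)/2}` by `k` modulo `5`; the relation `U V = f_5^2` is proved by a
sign-reversing reflection on a lattice of pairs of integers
(`sum_pentagonalPart_mul_eq_zero`), without the triple product identity. Multiplying the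
conjugates `f_1(ζ q)`, `ζ^5 = 1`, computed once as infinite products and once from the dissection,
yields the modular equation.
-/

namespace TwoColor

open PowerSeries

/-! ### Coefficients along arithmetic progressions -/

/-- The series `∑ a(N n + c) q^n` obtained from `∑ a(n) q^n`. For `N = 5` and `c = 0` this is
Atkin's operator `U_5`. -/
noncomputable def progression (N c : ℕ) : ℚ⟦X⟧ →ₗ[ℚ] ℚ⟦X⟧ where
  toFun F := mk fun n => coeff (N * n + c) F
  map_add' F G := by ext; simp
  map_smul' a F := by ext; simp

@[simp]
theorem coeff_progression (N c n : ℕ) (F : ℚ⟦X⟧) :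
    coeff n (progression N c F) = coeff (N * n + c) F := by
  simp [progression]

theorem progression_progression (M N c d : ℕ) (F : ℚ⟦X⟧) :
    progression M d (progression N c F) = progression (N * M) (N * d + c) F := by
  ext n
  simp only [coeff_progression]
  rw [show N * (M * n + d) + c = N * M * n + (N * d + c) by ring]

/-- `progression N c` is linear over the series in `q^N`. For `c ≥ N` this fails. -/
theorem progression_expand_mul {N c : ℕ} (hN : N ≠ 0) (hc : c < N) (F G : ℚ⟦X⟧) :
    progression N c (expand N hN F * G) = F * progression N c G := by
  ext n
  simp only [coeff_progression, coeff_mul]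
  symm
  refine Finset.sum_of_injOn (fun p => (N * p.1, N * p.2 + c)) ?_ ?_ ?_ ?_
  · rintro ⟨a, b⟩ - ⟨a', b'⟩ - h
    simp only [Prod.mk.injEq, add_left_inj] at h
    exact Prod.ext (Nat.eq_of_mul_eq_mul_left (by omega) h.1)
      (Nat.eq_of_mul_eq_mul_left (by omega) h.2)
  · rintro ⟨a, b⟩ h
    simp only [Finset.mem_coe, Finset.HasAntidiagonal.mem_antidiagonal] at h ⊢
    rw [← h]
    ring
  · rintro ⟨a, b⟩ h hn
    simp only [Finset.HasAntidiagonal.mem_antidiagonal] at h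
    by_cases hd : N ∣ a
    · exfalso
      obtain ⟨a, rfl⟩ := hd
      have han : a ≤ n := by
        by_contra hlt
        have : N * (n + 1) ≤ N * a := Nat.mul_le_mul_left N (by omega)
        rw [mul_add] at this
        omega
      obtain ⟨b', rfl⟩ := Nat.exists_eq_add_of_le han
      refine hn ⟨(a, b'), by simp, ?_⟩
      rw [mul_add] at h
      simp only [Prod.mk.injEq, true_and]
      omega
    · simp [coeff_expand_of_not_dvd N hN F hd]
  · rintro ⟨a, b⟩ -
    simp

theorem progression_expand {N : ℕ} (hN : N ≠ 0) (F : ℚ⟦X⟧) :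
    progression N 0 (expand N hN F) = F := by
  ext n
  simp

/-- A shift by `e` moves the residue class `c = N - e` to `0`. -/
theorem progression_X_pow_mul {N c e : ℕ} (he : e + c = N) (he' : e ≠ 0) (F : ℚ⟦X⟧) :
    progression N 0 (X ^ e * F) = X * progression N c F := by
  ext n
  rw [coeff_progression]
  cases n with
  | zero => simp [he']
  | succ n =>
    rw [coeff_succ_X_mul, coeff_progression, show N * (n + 1) + 0 = (N * n + c) + e by
      rw [mul_add]; omega, coeff_X_pow_mul]

/-- A series all of whose exponents are congruent to `c` modulo `N`, as a series in `q^N`. -/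
theorem eq_X_pow_mul_expand {N c : ℕ} (hN : N ≠ 0) (hc : c < N) {F : ℚ⟦X⟧}
    (h : ∀ n, n % N ≠ c → coeff n F = 0) :
    F = X ^ c * expand N hN (progression N c F) := by
  ext n
  rw [coeff_X_pow_mul']
  by_cases hn : n % N = c
  · have h1 := Nat.div_add_mod n N
    rw [hn] at h1
    rw [if_pos (by omega), ← h1, Nat.add_sub_cancel, coeff_expand_mul, coeff_progression]
  · rw [h n hn]
    split_ifs with hcn
    · rw [coeff_expand_of_not_dvd]
      rintro ⟨d, hd⟩
      apply hn
      rw [show n = c + N * d by omega, Nat.add_mul_mod_self_left, Nat.mod_eq_of_lt hc]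
    · rfl

/-! ### The `5`-dissection of the Euler product -/

theorem natAbs_le_pentagonal (k : ℤ) : k.natAbs ≤ pentagonal k := by
  have h := two_mul_natCast_pentagonal k
  zify
  rcases abs_cases k with ⟨h1, h2⟩ | ⟨h1, h2⟩ <;> rw [h1]
  · by_cases h0 : k = 0
    · simp [h0]
    · nlinarith [show 1 ≤ k by omega]
  · nlinarith

/-- For `0 ≤ j < 5`, the part `∑ (-1)^k q^{k(3k-1)/2}`, `k ≡ j (mod 5)`, of the pentagonal number
series. -/
noncomputable def pentagonalPart (j : ℤ) : ℚ⟦X⟧ :=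
  mk fun n => ∑ k ∈ Finset.Icc (-n : ℤ) n,
    if pentagonal k = n ∧ k % 5 = j then ((k.negOnePow : ℤ) : ℚ) else 0

theorem coeff_pentagonalPart_of_le (j : ℤ) {n B : ℕ} (h : n ≤ B) :
    coeff n (pentagonalPart j) = ∑ k ∈ Finset.Icc (-B : ℤ) B,
      if pentagonal k = n ∧ k % 5 = j then ((k.negOnePow : ℤ) : ℚ) else 0 := by
  rw [pentagonalPart, coeff_mk]
  refine Finset.sum_subset (Finset.Icc_subset_Icc (by omega) (by omega)) fun k _ hk => if_neg ?_
  rintro ⟨hk', -⟩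
  have := natAbs_le_pentagonal k
  apply hk
  rw [Finset.mem_Icc]
  omega

theorem coeff_pentagonalPart_pentagonal (j k : ℤ) :
    coeff (pentagonal k) (pentagonalPart j) =
      if k % 5 = j then ((k.negOnePow : ℤ) : ℚ) else 0 := by
  rw [pentagonalPart, coeff_mk, Finset.sum_eq_single k]
  · simp
  · intro l _ hl
    simp [hl]
  · intro hk
    have := natAbs_le_pentagonal k
    rw [Finset.mem_Icc] at hk
    omega

theorem coeff_pentagonalPart_eq_zero (j : ℤ) {n : ℕ}
    (h : ∀ k, pentagonal k = n → k % 5 ≠ j) :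
    coeff n (pentagonalPart j) = 0 := by
  rw [pentagonalPart, coeff_mk]
  exact Finset.sum_eq_zero fun k _ => if_neg fun hk => h k hk.1 hk.2

theorem pentagonalSeries_eq_sum :
    pentagonalSeries ℚ = pentagonalPart 0 + pentagonalPart 1 + pentagonalPart 2
      + pentagonalPart 3 + pentagonalPart 4 := by
  ext n
  simp only [map_add]
  by_cases h : n ∈ Set.range pentagonal
  · obtain ⟨k, rfl⟩ := h
    simp only [coeff_pentagonalSeries_pentagonal, coeff_pentagonalPart_pentagonal]
    have : k % 5 = 0 ∨ k % 5 = 1 ∨ k % 5 = 2 ∨ k % 5 = 3 ∨ k % 5 = 4 := by omega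
    rcases this with h | h | h | h | h <;> simp [h]
  · rw [coeff_pentagonalSeries_eq_zero _ h]
    have h0 (j : ℤ) : coeff n (pentagonalPart j) = 0 :=
      coeff_pentagonalPart_eq_zero j fun k hk => (h ⟨k, hk⟩).elim
    simp [h0]

theorem pentagonal_mod_five (k : ℤ) :
    ((k % 5 = 0 ∨ k % 5 = 2) ∧ pentagonal k % 5 = 0) ∨ (k % 5 = 1 ∧ pentagonal k % 5 = 1) ∨
      ((k % 5 = 3 ∨ k % 5 = 4) ∧ pentagonal k % 5 = 2) := by
  have h := two_mul_natCast_pentagonal k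
  obtain ⟨r, t, hr, rfl⟩ : ∃ r t : ℤ, (0 ≤ r ∧ r < 5) ∧ k = r + 5 * t :=
    ⟨k % 5, k / 5, by omega, by omega⟩
  generalize pentagonal (r + 5 * t) = p at *
  have hr' : r = 0 ∨ r = 1 ∨ r = 2 ∨ r = 3 ∨ r = 4 := by omega
  ring_nf at h
  rcases hr' with rfl | rfl | rfl | rfl | rfl <;> ring_nf at h <;> omega

theorem coeff_mul_pentagonalPart (i j : ℤ) (N : ℕ) :
    coeff N (pentagonalPart i * pentagonalPart j) =
      ∑ p ∈ Finset.Icc (-N : ℤ) N ×ˢ Finset.Icc (-N : ℤ) N,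
        if pentagonal p.1 + pentagonal p.2 = N ∧ p.1 % 5 = i ∧ p.2 % 5 = j then
          (((p.1 + p.2).negOnePow : ℤ) : ℚ) else 0 := by
  rw [coeff_mul]
  have h1 : ∀ q ∈ Finset.HasAntidiagonal.antidiagonal N,
      coeff q.1 (pentagonalPart i) * coeff q.2 (pentagonalPart j) =
      ∑ p ∈ Finset.Icc (-N : ℤ) N ×ˢ Finset.Icc (-N : ℤ) N,
        if q = (pentagonal p.1, pentagonal p.2) then
          (if p.1 % 5 = i ∧ p.2 % 5 = j then (((p.1 + p.2).negOnePow : ℤ) : ℚ) else 0)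
        else 0 := by
    rintro ⟨a, b⟩ hq
    rw [Finset.HasAntidiagonal.mem_antidiagonal] at hq
    simp only at hq ⊢
    rw [coeff_pentagonalPart_of_le i (show a ≤ N by omega),
      coeff_pentagonalPart_of_le j (show b ≤ N by omega), Finset.sum_mul_sum,
      ← Finset.sum_product']
    refine Finset.sum_congr rfl fun p _ => ?_
    simp only [Prod.mk.injEq, Int.negOnePow_add, Units.val_mul, Int.cast_mul]
    grind
  rw [Finset.sum_congr rfl h1, Finset.sum_comm]
  refine Finset.sum_congr rfl fun p _ => ?_
  rw [Finset.sum_ite_eq']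
  simp only [Finset.HasAntidiagonal.mem_antidiagonal]
  split_ifs <;> tauto

/-- The lattice pairs `(k, l)` with `l = 2k - 1 + 5t` contribute nothing: for fixed `t` the
reflection `k ↦ 1 - 4t - k` preserves the exponent and changes the sign. -/
theorem sum_pentagonalPart_mul_eq_zero :
    pentagonalPart 0 * pentagonalPart 4 + pentagonalPart 1 * pentagonalPart 1
      + pentagonalPart 2 * pentagonalPart 3 + pentagonalPart 3 * pentagonalPart 0
      + pentagonalPart 4 * pentagonalPart 2 = 0 := by
  ext N
  simp only [map_add, coeff_mul_pentagonalPart, map_zero, ← Finset.sum_add_distrib]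
  have h1 (p : ℤ × ℤ) :
      (if pentagonal p.1 + pentagonal p.2 = N ∧ p.1 % 5 = 0 ∧ p.2 % 5 = 4 then
        (((p.1 + p.2).negOnePow : ℤ) : ℚ) else 0) +
      (if pentagonal p.1 + pentagonal p.2 = N ∧ p.1 % 5 = 1 ∧ p.2 % 5 = 1 then
        (((p.1 + p.2).negOnePow : ℤ) : ℚ) else 0) +
      (if pentagonal p.1 + pentagonal p.2 = N ∧ p.1 % 5 = 2 ∧ p.2 % 5 = 3 then
        (((p.1 + p.2).negOnePow : ℤ) : ℚ) else 0) +
      (if pentagonal p.1 + pentagonal p.2 = N ∧ p.1 % 5 = 3 ∧ p.2 % 5 = 0 then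
        (((p.1 + p.2).negOnePow : ℤ) : ℚ) else 0) +
      (if pentagonal p.1 + pentagonal p.2 = N ∧ p.1 % 5 = 4 ∧ p.2 % 5 = 2 then
        (((p.1 + p.2).negOnePow : ℤ) : ℚ) else 0) =
      if pentagonal p.1 + pentagonal p.2 = N ∧ (p.2 - 2 * p.1 + 1) % 5 = 0 then
          (((p.1 + p.2).negOnePow : ℤ) : ℚ) else 0 := by
    obtain ⟨k, l⟩ := p
    by_cases hN : pentagonal k + pentagonal l = N
    swap
    · simp [hN]
    simp only [hN, true_and]
    have : k % 5 = 0 ∨ k % 5 = 1 ∨ k % 5 = 2 ∨ k % 5 = 3 ∨ k % 5 = 4 := by omega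
    rcases this with h | h | h | h | h <;> simp only [h] <;> norm_num <;>
      refine if_congr ?_ rfl rfl <;> omega
  rw [Finset.sum_congr rfl fun p _ => h1 p, ← Finset.sum_filter]
  -- With `t = (l - 2k + 1) / 5`, the new pair is `(1 - 4t - k, 1 - 3t - 2k)`.
  refine Finset.sum_involution
    (fun p _ => (1 - 4 * ((p.2 - 2 * p.1 + 1) / 5) - p.1,
      1 - 3 * ((p.2 - 2 * p.1 + 1) / 5) - 2 * p.1)) ?_ ?_ ?_ ?_
  all_goals
    rintro ⟨k, l⟩ hp
    simp only [Finset.mem_filter, Finset.mem_product] at hp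
    obtain ⟨-, hN, h5⟩ := hp
    obtain ⟨t, rfl⟩ : ∃ t, l = 2 * k - 1 + 5 * t := ⟨(l - 2 * k + 1) / 5, by omega⟩
    rw [show (2 * k - 1 + 5 * t - 2 * k + 1) / 5 = t by omega]
  · rw [show 1 - 4 * t - k + (1 - 3 * t - 2 * k)
      = k + (2 * k - 1 + 5 * t) + (2 * (1 - 3 * k - 6 * t) + 1) by ring,
      Int.negOnePow_add _ (2 * (1 - 3 * k - 6 * t) + 1),
      Int.negOnePow_odd _ ⟨_, rfl⟩]
    push_cast
    ring
  · intro _ h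
    simp only [Prod.mk.injEq] at h
    omega
  · have hN' : pentagonal (1 - 4 * t - k) + pentagonal (1 - 3 * t - 2 * k) = N := by
      zify at hN ⊢
      have e1 := two_mul_natCast_pentagonal k
      have e2 := two_mul_natCast_pentagonal (2 * k - 1 + 5 * t)
      have e3 := two_mul_natCast_pentagonal (1 - 4 * t - k)
      have e4 := two_mul_natCast_pentagonal (1 - 3 * t - 2 * k)
      linarith
    have b1 := natAbs_le_pentagonal (1 - 4 * t - k)
    have b2 := natAbs_le_pentagonal (1 - 3 * t - 2 * k)
    simp only [Finset.mem_filter, Finset.mem_product, Finset.mem_Icc]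
    refine ⟨by omega, hN', by omega⟩
  · simp only [Prod.mk.injEq]
    omega

theorem pentagonalPart_one :
    pentagonalPart 1 = -(X * expand 25 (by norm_num) (pentagonalSeries ℚ)) := by
  have hp (k : ℤ) : pentagonal (5 * k + 1) = 25 * pentagonal (-k) + 1 := by
    have e1 := two_mul_natCast_pentagonal (5 * k + 1)
    have e2 := two_mul_natCast_pentagonal (-k)
    zify
    linarith
  ext n
  by_cases h : ∃ k, pentagonal k = n ∧ k % 5 = 1
  · obtain ⟨k, rfl, hk⟩ := h
    obtain ⟨k, rfl⟩ : ∃ l, k = 5 * l + 1 := ⟨k / 5, by omega⟩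
    rw [coeff_pentagonalPart_pentagonal, if_pos hk, hp, map_neg, coeff_succ_X_mul,
      coeff_expand_mul, coeff_pentagonalSeries_pentagonal, Int.negOnePow_succ,
      show 5 * k = -k + 2 * (3 * k) by ring, Int.negOnePow_add,
      Int.negOnePow_even _ (even_two_mul _)]
    simp
  · push Not at h
    rw [coeff_pentagonalPart_eq_zero _ h, map_neg]
    symm
    rw [neg_eq_zero]
    cases n with
    | zero => simp
    | succ n =>
      rw [coeff_succ_X_mul, coeff_expand]
      split_ifs with hd
      · obtain ⟨n, rfl⟩ := hd
        apply coeff_pentagonalSeries_eq_zero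
        rintro ⟨k, hk⟩
        refine h (5 * (-k) + 1) ?_ (by omega)
        rw [hp, neg_neg, hk, Nat.mul_div_cancel_left _ (by norm_num)]
      · rfl

/-! ### Euler products and their norms -/

theorem continuous_expand {R : Type*} [CommRing R] [TopologicalSpace R] {N : ℕ} (hN : N ≠ 0) :
    Continuous (expand N hN : R⟦X⟧ → R⟦X⟧) := by
  refine continuous_iff_continuousAt.mpr fun F => ?_
  rw [ContinuousAt, WithPiTopology.tendsto_iff_coeff_tendsto]
  intro d
  simp only [coeff_expand]
  split_ifs
  · exact (WithPiTopology.continuous_coeff R _).continuousAt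
  · exact tendsto_const_nhds

theorem continuous_rescale {R : Type*} [CommRing R] [TopologicalSpace R] [IsTopologicalRing R]
    (a : R) : Continuous (rescale a : R⟦X⟧ → R⟦X⟧) := by
  refine continuous_iff_continuousAt.mpr fun F => ?_
  rw [ContinuousAt, WithPiTopology.tendsto_iff_coeff_tendsto]
  intro d
  simp only [coeff_rescale]
  exact ((WithPiTopology.continuous_coeff R d).const_mul _).continuousAt

theorem f_one : f 1 = pentagonalSeries ℚ := by
  simp only [f, one_mul]
  exact WithPiTopology.tprod_one_sub_X_pow ℚ

theorem f_eq_expand {r : ℕ} (hr : r ≠ 0) : f r = expand r hr (f 1) := by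
  rw [f_one]
  have h := (WithPiTopology.hasProd_one_sub_X_pow ℚ).map (expand r hr) (continuous_expand hr)
  simp only [Function.comp_def, map_sub, map_one, map_pow, expand_X, ← pow_mul] at h
  exact h.tprod_eq

theorem f_mul {r s : ℕ} (hr : r ≠ 0) (hs : s ≠ 0) : f (r * s) = expand r hr (f s) := by
  rw [f_eq_expand hs, ← expand_mul, f_eq_expand]

/-- A product over the multiples of `N`, as a product over all positive integers. -/
theorem hasProd_multiples_iff {M : Type*} [CommMonoid M] [TopologicalSpace M] {N : ℕ}
    (hN : N ≠ 0) (g : ℕ → M) (a : M) :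
    HasProd (fun m => g (N * (m + 1))) a ↔
      HasProd (fun n => if N ∣ n + 1 then g (n + 1) else 1) a := by
  have h1 (m : ℕ) : N * (m + 1) - 1 + 1 = N * (m + 1) :=
    Nat.sub_add_cancel (Nat.mul_pos (Nat.pos_of_ne_zero hN) m.succ_pos)
  have hinj : Function.Injective fun m => N * (m + 1) - 1 := by
    intro a b hab
    have h2 : N * (a + 1) = N * (b + 1) := by
      rw [← h1 a, ← h1 b]
      exact congrArg (· + 1) hab
    have := Nat.eq_of_mul_eq_mul_left (Nat.pos_of_ne_zero hN) h2
    omega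
  rw [← hinj.hasProd_iff (f := fun n => if N ∣ n + 1 then g (n + 1) else 1)]
  · simp [Function.comp_def, h1]
  · intro n hn
    refine if_neg ?_
    rintro ⟨d, hd⟩
    refine hn ⟨d - 1, ?_⟩
    have : d ≠ 0 := by rintro rfl; omega
    simp only
    rw [Nat.sub_add_cancel (Nat.pos_of_ne_zero this), ← hd, Nat.add_sub_cancel]

/-- The norm of `a + b w + c w^2`, where `w` runs over the fifth roots of unity. -/
theorem prod_fifth_roots {R : Type*} [CommRing R] {w : R}
    (hw : 1 + w + w ^ 2 + w ^ 3 + w ^ 4 = 0) (a b c : R) :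
    ∏ j ∈ Finset.range 5, (a + w ^ j * b + (w ^ j) ^ 2 * c) =
      a ^ 5 + b ^ 5 + c ^ 5 - 5 * a * b ^ 3 * c + 5 * a ^ 2 * b * c ^ 2 := by
  have h5 : w ^ 5 = 1 := by linear_combination (w - 1) * hw
  -- Conjugate factors are multiplied first; `τ = w + w^4` satisfies `τ^2 + τ = 1`.
  obtain ⟨τ, hτ⟩ : ∃ τ, τ = w + w ^ 4 := ⟨_, rfl⟩
  have hτ2 : τ ^ 2 + τ = 1 := by
    rw [hτ]
    linear_combination hw + (w ^ 3 + 2) * h5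
  have h23 : w ^ 2 + w ^ 3 = -1 - τ := by linear_combination hw + hτ
  have p14 : (a + w * b + w ^ 2 * c) * (a + w ^ 4 * b + w ^ 3 * c) =
      a ^ 2 + b ^ 2 + c ^ 2 + τ * (a * b + b * c) + (-1 - τ) * (a * c) := by
    linear_combination (b ^ 2 + c ^ 2 + b * c * w) * h5 - (a * b + b * c) * hτ + a * c * h23
  have p23 : (a + w ^ 2 * b + w ^ 4 * c) * (a + w ^ 3 * b + w * c) =
      a ^ 2 + b ^ 2 + c ^ 2 + (-1 - τ) * (a * b + b * c) + τ * (a * c) := by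
    linear_combination (b ^ 2 + c ^ 2 + b * c * w ^ 2) * h5 + (a * b + b * c) * h23 - a * c * hτ
  have e6 : w ^ 6 = w := by linear_combination w * h5
  have e8 : w ^ 8 = w ^ 3 := by linear_combination w ^ 3 * h5
  simp only [Finset.prod_range_succ, Finset.prod_range_zero, one_mul, ← pow_mul]
  norm_num only
  rw [e6, e8]
  simp only [pow_zero, pow_one, one_mul]
  calc _ = (a + b + c) * ((a + w * b + w ^ 2 * c) * (a + w ^ 4 * b + w ^ 3 * c)) *
        ((a + w ^ 2 * b + w ^ 4 * c) * (a + w ^ 3 * b + w * c)) := by ring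
    _ = _ := by
      rw [p14, p23]
      linear_combination (-(a + b + c) * (a * b + b * c - a * c) ^ 2) * hτ2

theorem map_pentagonalSeries {R S : Type*} [CommRing R] [CommRing S] (φ : R →+* S) :
    PowerSeries.map φ (pentagonalSeries R) = pentagonalSeries S := by
  ext n
  rw [coeff_map]
  by_cases h : n ∈ Set.range pentagonal
  · obtain ⟨k, rfl⟩ := h
    simp
  · rw [coeff_pentagonalSeries_eq_zero _ h, coeff_pentagonalSeries_eq_zero _ h, map_zero]

theorem sum_pow_eq_zero {R : Type*} [CommRing R] [IsDomain R] {w : R} (h5 : w ^ 5 = 1)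
    (h1 : w ≠ 1) : 1 + w + w ^ 2 + w ^ 3 + w ^ 4 = 0 := by
  refine (mul_eq_zero.mp ?_).resolve_left (sub_ne_zero.mpr h1)
  linear_combination h5

/-- The norm of the Euler product from `ℂ⟦q⟧` to `ℂ⟦q^5⟧`. -/
theorem prod_rescale_pentagonalSeries {ζ : ℂ} (hζ : IsPrimitiveRoot ζ 5) :
    (∏ j ∈ Finset.range 5, rescale (ζ ^ j) (pentagonalSeries ℂ)) *
        expand 25 (by norm_num) (pentagonalSeries ℂ) =
      expand 5 (by norm_num) (pentagonalSeries ℂ) ^ 6 := by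
  have hE := WithPiTopology.hasProd_one_sub_X_pow ℂ
  have hex {N : ℕ} (hN : N ≠ 0) := hE.map (expand N hN) (continuous_expand hN)
  simp only [Function.comp_def, map_sub, map_one, map_pow, expand_X, ← pow_mul] at hex
  have hnorm : HasProd _ (∏ j ∈ Finset.range 5, rescale (ζ ^ j) (pentagonalSeries ℂ)) :=
    hasProd_prod fun j _ => hE.map (rescale (ζ ^ j)) (continuous_rescale _)
  have h25 := hex (show 25 ≠ 0 by norm_num)
  have h5 := hex (show 5 ≠ 0 by norm_num)
  have h55 : HasProd (fun m : ℕ => ((1 : ℂ⟦X⟧) - X ^ (5 * (m + 1))) ^ 5)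
      (expand 5 (by norm_num) (pentagonalSeries ℂ) ^ 5) := by
    simpa using hasProd_prod (s := Finset.range 5) fun _ _ => h5
  rw [hasProd_multiples_iff (by norm_num) fun n => ((1 : ℂ⟦X⟧) - X ^ n) ^ 5] at h55
  simp only [show ∀ m, 25 * (m + 1) = 5 * (5 * (m + 1)) by intro m; ring] at h25
  rw [hasProd_multiples_iff (by norm_num) fun n => (1 : ℂ⟦X⟧) - X ^ (5 * n)] at h25
  refine (hnorm.mul h25).unique ?_
  rw [pow_succ]
  convert h55.mul h5 using 2 with n
  have hC (j : ℕ) : rescale (ζ ^ j) ((1 : ℂ⟦X⟧) - X ^ (n + 1)) =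
      1 + (C (ζ ^ (n + 1))) ^ j * (-X ^ (n + 1)) + ((C (ζ ^ (n + 1))) ^ j) ^ 2 * 0 := by
    simp only [map_sub, map_one, map_pow, rescale_X, mul_pow]
    ring
  simp only [Function.comp_apply, hC]
  split_ifs with hd
  · obtain ⟨d, hd⟩ := hd
    have : ζ ^ (n + 1) = 1 := by rw [hd, pow_mul, hζ.pow_eq_one, one_pow]
    simp [this, sub_eq_add_neg]
  · rw [prod_fifth_roots]
    · ring
    · rw [← map_one C]
      simp only [← map_pow, ← map_add]
      rw [sum_pow_eq_zero, map_zero]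
      · rw [← pow_mul, mul_comm, pow_mul, hζ.pow_eq_one, one_pow]
      · rwa [Ne, hζ.pow_eq_one_iff_dvd]

/-! ### The modular equation of degree `5` -/

theorem rescale_expand {R : Type*} [CommRing R] {N : ℕ} (hN : N ≠ 0) {a : R} (ha : a ^ N = 1)
    (F : R⟦X⟧) : rescale a (expand N hN F) = expand N hN F := by
  ext n
  rw [coeff_rescale]
  by_cases h : N ∣ n
  · obtain ⟨d, rfl⟩ := h
    rw [pow_mul, ha, one_pow, one_mul]
  · rw [coeff_expand_of_not_dvd _ _ _ h, mul_zero]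

/-- The dissection of the Euler product modulo `5`: the pentagonal numbers `k(3k-1)/2` are
congruent to `0`, `1` or `2`, and those congruent to `1` are `1 + 25 l(3l+1)/2`. The series `V / U`
is the square of the Rogers–Ramanujan continued fraction (without its fractional power of `q`),
but only `U V = f_5^2` is needed. -/
theorem exists_dissection : ∃ U V : ℚ⟦X⟧, U * V = f 5 ^ 2 ∧
    f 1 = expand 5 (by norm_num) U - X * f 25 - X ^ 2 * expand 5 (by norm_num) V := by
  have h5 : (5 : ℕ) ≠ 0 := by norm_num
  have hU := eq_X_pow_mul_expand (F := pentagonalPart 0 + pentagonalPart 2) h5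
    (show 0 < 5 by norm_num) fun n hn => by
      rw [map_add, coeff_pentagonalPart_eq_zero, coeff_pentagonalPart_eq_zero, add_zero] <;>
      · rintro k rfl hk
        have := pentagonal_mod_five k
        omega
  have hV := eq_X_pow_mul_expand (F := pentagonalPart 3 + pentagonalPart 4) h5
    (show 2 < 5 by norm_num) fun n hn => by
      rw [map_add, coeff_pentagonalPart_eq_zero, coeff_pentagonalPart_eq_zero, add_zero] <;>
      · rintro k rfl hk
        have := pentagonal_mod_five k
        omega
  have h1 := pentagonalPart_one
  rw [← f_one, ← f_eq_expand] at h1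
  have hsum := sum_pentagonalPart_mul_eq_zero
  set U := progression 5 0 (pentagonalPart 0 + pentagonalPart 2)
  set V := progression 5 2 (pentagonalPart 3 + pentagonalPart 4)
  refine ⟨U, -V, ?_, ?_⟩
  · apply_fun expand 5 h5 using fun F G h => by
      rw [← progression_expand h5 F, h, progression_expand h5]
    have hX : (X : ℚ⟦X⟧) ^ 2 ≠ 0 := pow_ne_zero _ X_ne_zero
    apply mul_left_cancel₀ hX
    rw [map_mul, map_neg, map_pow, ← show f 25 = expand 5 h5 (f 5) from f_mul h5 h5]
    rw [pow_zero, one_mul] at hU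
    rw [h1] at hsum
    linear_combination (pentagonalPart 3 + pentagonalPart 4) * hU + expand 5 h5 U * hV - hsum
  · rw [f_one, pentagonalSeries_eq_sum, h1, map_neg]
    rw [pow_zero, one_mul] at hU
    linear_combination hU + hV

/-- The modular equation of degree `5`: with `s = f_1 / (q f_25)` it reads
`f_5^6 / (q^5 f_25^6) = s^5 + 5 s^4 + 15 s^3 + 25 s^2 + 25 s`. -/
theorem modular_equation :
    f 5 ^ 6 = f 25 * f 1 * (f 1 ^ 4 + 5 * f 1 ^ 3 * (X * f 25) + 15 * f 1 ^ 2 * (X * f 25) ^ 2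
      + 25 * f 1 * (X * f 25) ^ 3 + 25 * (X * f 25) ^ 4) := by
  obtain ⟨U, V, hUV, hf⟩ := exists_dissection
  have h5 : (5 : ℕ) ≠ 0 := by norm_num
  have hUV' : expand 5 h5 U * expand 5 h5 V = f 25 ^ 2 := by
    rw [← map_mul, hUV, map_pow, ← show f 25 = expand 5 h5 (f 5) from f_mul h5 h5]
  -- The norm of the dissection, computed over `ℂ`.
  have key : f 5 ^ 6 = (expand 5 h5 U ^ 5 - 11 * (X * f 25) ^ 5
      - (X ^ 2 * expand 5 h5 V) ^ 5) * f 25 := by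
    have hζ := Complex.isPrimitiveRoot_exp 5 h5
    set ζ := Complex.exp (2 * Real.pi * Complex.I / (5 : ℕ))
    have hn := prod_rescale_pentagonalSeries hζ
    apply PowerSeries.map_injective (algebraMap ℚ ℂ) (algebraMap ℚ ℂ).injective
    have hr (j : ℕ) : rescale (ζ ^ j) (pentagonalSeries ℂ) =
        PowerSeries.map (algebraMap ℚ ℂ) (expand 5 h5 U)
        + (C ζ) ^ j * (-(X * PowerSeries.map (algebraMap ℚ ℂ) (f 25)))
        + ((C ζ) ^ j) ^ 2 *
          (-(X ^ 2 * PowerSeries.map (algebraMap ℚ ℂ) (expand 5 h5 V))) := by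
      have hj : (ζ ^ j) ^ 5 = 1 := by rw [← pow_mul, mul_comm, pow_mul, hζ.pow_eq_one, one_pow]
      rw [← map_pentagonalSeries (algebraMap ℚ ℂ), ← f_one, hf,
        show f 25 = expand 5 h5 (f 5) from f_mul h5 h5]
      simp only [map_sub, map_mul, map_pow, map_X, rescale_X, map_expand, rescale_expand h5 hj]
      ring
    have hw : 1 + C ζ + C ζ ^ 2 + C ζ ^ 3 + C ζ ^ 4 = 0 := by
      rw [← map_one C]
      simp only [← map_pow, ← map_add]
      rw [sum_pow_eq_zero hζ.pow_eq_one (hζ.ne_one (by norm_num)), map_zero]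
    simp only [hr] at hn
    rw [prod_fifth_roots hw, ← map_pentagonalSeries (algebraMap ℚ ℂ), ← map_expand, ← map_expand,
      ← f_one, ← f_eq_expand, ← f_eq_expand] at hn
    have hm := congrArg (PowerSeries.map (algebraMap ℚ ℂ)) hUV'
    simp only [map_mul, map_pow, map_sub, map_X, map_ofNat] at hm ⊢
    rw [← hn]
    generalize PowerSeries.map (algebraMap ℚ ℂ) (expand 5 h5 U) = a at *
    generalize PowerSeries.map (algebraMap ℚ ℂ) (expand 5 h5 V) = c at *
    generalize PowerSeries.map (algebraMap ℚ ℂ) (f 25) = b at *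
    linear_combination (-5 * X ^ 5 * b ^ 4 - 5 * X ^ 5 * b ^ 2 * (a * c + b ^ 2)) * hm
  rw [key]
  generalize expand 5 h5 U = a at *
  generalize expand 5 h5 V = c at *
  rw [hf]
  generalize f 25 = b at *
  -- Both sides agree up to a multiple of `a * c - b ^ 2`.
  linear_combination X ^ 2 * b * (5 * a ^ 3 - 10 * a ^ 2 * (X ^ 2 * c) + 5 * a * (X * b) ^ 2
    + 10 * a * (X ^ 2 * c) ^ 2 - 5 * (X * b) ^ 2 * (X ^ 2 * c) - 5 * (X ^ 2 * c) ^ 3) * hUV'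

/-! ### The action of `U_5` on powers of `q f_25 / f_1` -/

theorem f_mul_inv {r : ℕ} (hr : r ≠ 0) : f r * (f r)⁻¹ = 1 :=
  PowerSeries.mul_inv_cancel _ (by simp [constantCoeff_f (Nat.one_le_iff_ne_zero.mpr hr)])

theorem f_inv_mul {r s : ℕ} (hr : r ≠ 0) (hs : s ≠ 0) :
    (f (r * s))⁻¹ = expand r hr (f s)⁻¹ := by
  have h : expand r hr (f s) * expand r hr (f s)⁻¹ = 1 := by
    rw [← map_mul, f_mul_inv hs, map_one]
  rw [← f_mul hr hs] at h
  linear_combination expand r hr (f s)⁻¹ * f_mul_inv (mul_ne_zero hr hs) - (f (r * s))⁻¹ * h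

theorem f_five : f 5 = expand 5 (by norm_num) (f 1) := f_eq_expand _

theorem f_twentyFive : f 25 = expand 5 (by norm_num) (f 5) :=
  f_mul (r := 5) (s := 5) (by norm_num) (by norm_num)

theorem progression_f_five_pow_mul (c : ℕ) (G : ℚ⟦X⟧) :
    progression 5 0 (f 5 ^ c * G) = f 1 ^ c * progression 5 0 G := by
  rw [f_five, ← map_pow, progression_expand_mul _ (by norm_num)]

theorem progression_f_twentyFive_pow_mul (c : ℕ) (G : ℚ⟦X⟧) :
    progression 5 0 (f 25 ^ c * G) = f 5 ^ c * progression 5 0 G := by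
  rw [f_twentyFive, ← map_pow, progression_expand_mul _ (by norm_num)]

theorem progression_f_twentyFive_inv_pow_mul (c : ℕ) (G : ℚ⟦X⟧) :
    progression 5 0 ((f 25)⁻¹ ^ c * G) = (f 5)⁻¹ ^ c * progression 5 0 G := by
  have h5 : (5 : ℕ) ≠ 0 := by norm_num
  rw [show (f 25)⁻¹ = expand 5 h5 (f 5)⁻¹ from f_inv_mul h5 h5, ← map_pow,
    progression_expand_mul _ (by norm_num)]

theorem progression_X_pow_five_mul_mul (i : ℕ) (G : ℚ⟦X⟧) :
    progression 5 0 (X ^ (5 * i) * G) = X ^ i * progression 5 0 G := by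
  rw [pow_mul, ← expand_X 5 (by norm_num), ← map_pow, progression_expand_mul _ (by norm_num)]

theorem progression_one : progression 5 0 1 = 1 := by
  simpa using progression_expand (show 5 ≠ 0 by norm_num) 1

/-- `U_5` picks the first component of a `5`-dissection. -/
theorem progression_dissected (G₀ G₁ G₂ G₃ G₄ : ℚ⟦X⟧) :
    progression 5 0 (expand 5 (by norm_num) G₀ + X * expand 5 (by norm_num) G₁
      + X ^ 2 * expand 5 (by norm_num) G₂ + X ^ 3 * expand 5 (by norm_num) G₃
      + X ^ 4 * expand 5 (by norm_num) G₄) = G₀ := by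
  have h (e : ℕ) (he : ¬ 5 ∣ e) (G : ℚ⟦X⟧) :
      progression 5 0 (X ^ e * expand 5 (by norm_num) G) = 0 := by
    rw [mul_comm, progression_expand_mul _ (by norm_num)]
    ext n
    rw [mul_comm, coeff_mul]
    refine Finset.sum_eq_zero fun p _ => ?_
    rw [coeff_progression, coeff_X_pow, if_neg (by omega), zero_mul]
  have h1 := h 1 (by norm_num) G₁
  rw [pow_one] at h1
  simp only [map_add, h1, h 2 (by norm_num), h 3 (by norm_num), h 4 (by norm_num),
    progression_expand, add_zero]

/-- The values of `U_5` from which those of `U_5(t^i)` for `i ≤ 4` are computed. Each power of `f_1`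
is expanded by the dissection, and its exponents are sorted modulo `5`. -/
theorem progression_X_mul_f_pow :
    progression 5 0 (X * f 1 ^ 4) = -5 * X * f 5 ^ 4 ∧
    progression 5 0 (X ^ 2 * f 1 ^ 3) = 5 * X * f 5 ^ 3 ∧
    progression 5 0 (X ^ 3 * f 1 ^ 2) = -X * f 5 ^ 2 ∧
    progression 5 0 (X ^ 4 * f 1) = -X * f 5 := by
  obtain ⟨u, v, huv, hf⟩ := exists_dissection
  rw [f_twentyFive] at hf
  generalize f 5 = φ at *
  refine ⟨?_, ?_, ?_, ?_⟩
  · trans X * (φ ^ 4 - 12 * u * φ ^ 2 * v + 6 * u ^ 2 * v ^ 2)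
    · rw [← progression_dissected (X * (φ ^ 4 - 12 * u * φ ^ 2 * v + 6 * u ^ 2 * v ^ 2))
        (u ^ 4 + X * (4 * φ ^ 3 * v - 12 * u * φ * v ^ 2))
        (-4 * u ^ 3 * φ + X * (6 * φ ^ 2 * v ^ 2 - 4 * u * v ^ 3))
        (6 * u ^ 2 * φ ^ 2 - 4 * u ^ 3 * v + X * (4 * φ * v ^ 3))
        (-4 * u * φ ^ 3 + 12 * u ^ 2 * φ * v + X * v ^ 4), hf]
      congr 1
      simp only [map_add, map_sub, map_mul, map_pow, map_neg, map_ofNat, expand_X]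
      ring
    · linear_combination X * (-12 * φ ^ 2 + 6 * (u * v + φ ^ 2)) * huv
  · trans X * (-φ ^ 3 + 6 * u * φ * v)
    · rw [← progression_dissected (X * (-φ ^ 3 + 6 * u * φ * v))
        (X * (3 * u * v ^ 2 - 3 * φ ^ 2 * v)) (u ^ 3 - 3 * X * φ * v ^ 2)
        (-3 * u ^ 2 * φ - X * v ^ 3) (3 * u * φ ^ 2 - 3 * u ^ 2 * v), hf]
      congr 1
      simp only [map_add, map_sub, map_mul, map_pow, map_neg, map_ofNat, expand_X]
      ring
    · linear_combination 6 * X * φ * huv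
  · trans X * (φ ^ 2 - 2 * u * v)
    · rw [← progression_dissected (X * (φ ^ 2 - 2 * u * v)) (2 * X * φ * v) (X * v ^ 2)
        (u ^ 2) (-2 * u * φ), hf]
      congr 1
      simp only [map_sub, map_mul, map_pow, map_neg, map_ofNat, expand_X]
      ring
    · linear_combination -2 * X * huv
  · rw [← progression_dissected (-X * φ) (-X * v) 0 0 u, hf]
    congr 1
    simp only [map_mul, map_neg, map_zero, expand_X]
    ring

/-- The series `t = q f_25 / f_1`, a Hauptmodul for `Γ_0(25)`. -/
noncomputable def hauptmodul25 : ℚ⟦X⟧ := X * f 25 * (f 1)⁻¹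

/-- The series `T = q f_5^6 / f_1^6`, a Hauptmodul for `Γ_0(5)`. -/
noncomputable def hauptmodul5 : ℚ⟦X⟧ := X * f 5 ^ 6 * (f 1)⁻¹ ^ 6

/-- Cancels the factor `f_5^6` by which `t^i` is multiplied before `U_5` is applied. -/
theorem progression_eq_hauptmodul5_mul {F G : ℚ⟦X⟧}
    (h : progression 5 0 (f 5 ^ 6 * F) = X * f 5 ^ 6 * G) :
    progression 5 0 F = hauptmodul5 * G := by
  rw [progression_f_five_pow_mul] at h
  have h1 : f 1 ^ 6 * (f 1)⁻¹ ^ 6 = 1 := by rw [← mul_pow, f_mul_inv one_ne_zero, one_pow]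
  rw [hauptmodul5]
  linear_combination (f 1)⁻¹ ^ 6 * h - progression 5 0 F * h1

/-- The modular equation, multiplied by `t^i` and acted on by `U_5`. -/
theorem progression_hauptmodul25_pow_add_five (i : ℕ) :
    progression 5 0 (hauptmodul25 ^ (i + 5)) = hauptmodul5 *
      (25 * progression 5 0 (hauptmodul25 ^ (i + 4)) + 25 * progression 5 0 (hauptmodul25 ^ (i + 3))
        + 15 * progression 5 0 (hauptmodul25 ^ (i + 2))
        + 5 * progression 5 0 (hauptmodul25 ^ (i + 1)) + progression 5 0 (hauptmodul25 ^ i)) := by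
  apply progression_eq_hauptmodul5_mul
  have h1 := f_mul_inv one_ne_zero
  have key : f 5 ^ 6 * hauptmodul25 ^ (i + 5) = X ^ (5 * 1) * (f 25 ^ 6 *
      ((25 : ℚ) • hauptmodul25 ^ (i + 4) + (25 : ℚ) • hauptmodul25 ^ (i + 3)
        + (15 : ℚ) • hauptmodul25 ^ (i + 2) + (5 : ℚ) • hauptmodul25 ^ (i + 1)
        + hauptmodul25 ^ i)) := by
    have hme := modular_equation
    simp only [smul_eq_C_mul, map_ofNat]
    have hs : f 1 * hauptmodul25 = X * f 25 := by
      rw [hauptmodul25]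
      linear_combination X * f 25 * h1
    generalize hauptmodul25 = t at *
    generalize f 25 = b at *
    rw [← hs] at hme
    rw [show X ^ (5 * 1) * (b ^ 6 * (25 * t ^ (i + 4) + 25 * t ^ (i + 3) + 15 * t ^ (i + 2)
      + 5 * t ^ (i + 1) + t ^ i)) = b * (X * b) ^ 5 * (25 * t ^ (i + 4) + 25 * t ^ (i + 3)
      + 15 * t ^ (i + 2) + 5 * t ^ (i + 1) + t ^ i) by ring, ← hs]
    linear_combination t ^ (i + 5) * hme
  rw [key, progression_X_pow_five_mul_mul, progression_f_twentyFive_pow_mul]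
  simp only [map_add, map_smul]
  simp only [smul_eq_C_mul, map_ofNat]
  ring

/-- Negative powers of `t` are avoided: in `t^i / T(q^5)`, rewritten by the modular equation, the
terms that would be powers of `1 / t` become multiples of `q^(5-j) f_1^j`. -/
theorem progression_hauptmodul25_pow_one :
    progression 5 0 (hauptmodul25 ^ 1) = hauptmodul5 * 5 := by
  apply progression_eq_hauptmodul5_mul
  have h1 := f_mul_inv one_ne_zero
  obtain ⟨u1, u2, u3, u4⟩ := progression_X_mul_f_pow
  have key : f 5 ^ 6 * hauptmodul25 ^ 1 = f 25 ^ 2 * (X * f 1 ^ 4)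
      + (5 : ℚ) • (f 25 ^ 3 * (X ^ 2 * f 1 ^ 3)) + (15 : ℚ) • (f 25 ^ 4 * (X ^ 3 * f 1 ^ 2))
      + (25 : ℚ) • (f 25 ^ 5 * (X ^ 4 * f 1)) + (25 : ℚ) • (f 25 ^ 6 * (X ^ (5 * 1) * 1)) := by
    simp only [smul_eq_C_mul, map_ofNat, hauptmodul25]
    rw [modular_equation]
    generalize f 25 = b
    generalize (f 1)⁻¹ = g at *
    generalize f 1 = a at *
    linear_combination X * b ^ 2 * (a ^ 4 + 5 * a ^ 3 * (X * b) + 15 * a ^ 2 * (X * b) ^ 2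
      + 25 * a * (X * b) ^ 3 + 25 * (X * b) ^ 4) * h1
  rw [key]
  simp only [map_add, map_smul, progression_f_twentyFive_pow_mul, progression_X_pow_five_mul_mul,
    u1, u2, u3, u4]
  simp only [smul_eq_C_mul, map_ofNat, progression_one]
  ring

theorem progression_hauptmodul25_pow_two :
    progression 5 0 (hauptmodul25 ^ 2) =
      hauptmodul5 * (25 * progression 5 0 (hauptmodul25 ^ 1) + 10) := by
  apply progression_eq_hauptmodul5_mul
  have h1 := f_mul_inv one_ne_zero
  obtain ⟨-, u2, u3, u4⟩ := progression_X_mul_f_pow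
  have key : f 5 ^ 6 * hauptmodul25 ^ 2 = f 25 ^ 3 * (X ^ 2 * f 1 ^ 3)
      + (5 : ℚ) • (f 25 ^ 4 * (X ^ 3 * f 1 ^ 2)) + (15 : ℚ) • (f 25 ^ 5 * (X ^ 4 * f 1))
      + (25 : ℚ) • (f 25 ^ 6 * (X ^ (5 * 1) * 1))
      + (25 : ℚ) • (f 25 ^ 6 * (X ^ (5 * 1) * hauptmodul25 ^ 1)) := by
    simp only [smul_eq_C_mul, map_ofNat, hauptmodul25]
    rw [modular_equation]
    generalize f 25 = b
    generalize (f 1)⁻¹ = g at *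
    generalize f 1 = a at *
    linear_combination X ^ 2 * b ^ 3 * (a ^ 3 + 5 * a ^ 2 * (X * b) + 15 * a * (X * b) ^ 2
      + 25 * (X * b) ^ 3) * (a * g + 1) * h1 + X ^ 2 * b ^ 3 * 25 * (X * b) ^ 4 * g * h1
  rw [key]
  simp only [map_add, map_smul, progression_f_twentyFive_pow_mul, progression_X_pow_five_mul_mul,
    u2, u3, u4]
  simp only [smul_eq_C_mul, map_ofNat, progression_one]
  ring

theorem progression_hauptmodul25_pow_three :
    progression 5 0 (hauptmodul25 ^ 3) = hauptmodul5 *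
      (25 * progression 5 0 (hauptmodul25 ^ 2) + 25 * progression 5 0 (hauptmodul25 ^ 1) + 9) := by
  apply progression_eq_hauptmodul5_mul
  have h1 := f_mul_inv one_ne_zero
  obtain ⟨-, -, u3, u4⟩ := progression_X_mul_f_pow
  have key : f 5 ^ 6 * hauptmodul25 ^ 3 = f 25 ^ 4 * (X ^ 3 * f 1 ^ 2)
      + (5 : ℚ) • (f 25 ^ 5 * (X ^ 4 * f 1)) + (15 : ℚ) • (f 25 ^ 6 * (X ^ (5 * 1) * 1))
      + (25 : ℚ) • (f 25 ^ 6 * (X ^ (5 * 1) * hauptmodul25 ^ 1))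
      + (25 : ℚ) • (f 25 ^ 6 * (X ^ (5 * 1) * hauptmodul25 ^ 2)) := by
    simp only [smul_eq_C_mul, map_ofNat, hauptmodul25]
    rw [modular_equation]
    generalize f 25 = b
    generalize (f 1)⁻¹ = g at *
    generalize f 1 = a at *
    linear_combination X ^ 3 * b ^ 4 * ((a ^ 2 + 5 * a * (X * b) + 15 * (X * b) ^ 2)
      * ((a * g) ^ 2 + a * g + 1) + 25 * (X * b) ^ 3 * g * (a * g + 1)
      + 25 * (X * b) ^ 4 * g ^ 2) * h1
  rw [key]
  simp only [map_add, map_smul, progression_f_twentyFive_pow_mul, progression_X_pow_five_mul_mul,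
    u3, u4]
  simp only [smul_eq_C_mul, map_ofNat, progression_one]
  ring

theorem progression_hauptmodul25_pow_four :
    progression 5 0 (hauptmodul25 ^ 4) = hauptmodul5 *
      (25 * progression 5 0 (hauptmodul25 ^ 3) + 25 * progression 5 0 (hauptmodul25 ^ 2)
        + 15 * progression 5 0 (hauptmodul25 ^ 1) + 4) := by
  apply progression_eq_hauptmodul5_mul
  have h1 := f_mul_inv one_ne_zero
  obtain ⟨-, -, -, u4⟩ := progression_X_mul_f_pow
  have key : f 5 ^ 6 * hauptmodul25 ^ 4 = f 25 ^ 5 * (X ^ 4 * f 1)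
      + (5 : ℚ) • (f 25 ^ 6 * (X ^ (5 * 1) * 1))
      + (15 : ℚ) • (f 25 ^ 6 * (X ^ (5 * 1) * hauptmodul25 ^ 1))
      + (25 : ℚ) • (f 25 ^ 6 * (X ^ (5 * 1) * hauptmodul25 ^ 2))
      + (25 : ℚ) • (f 25 ^ 6 * (X ^ (5 * 1) * hauptmodul25 ^ 3)) := by
    simp only [smul_eq_C_mul, map_ofNat, hauptmodul25]
    rw [modular_equation]
    generalize f 25 = b
    generalize (f 1)⁻¹ = g at *
    generalize f 1 = a at *
    linear_combination X ^ 4 * b ^ 5 * ((a + 5 * (X * b))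
      * ((a * g) ^ 3 + (a * g) ^ 2 + a * g + 1) + 15 * (X * b) ^ 2 * g * ((a * g) ^ 2 + a * g + 1)
      + 25 * (X * b) ^ 3 * g ^ 2 * (a * g + 1) + 25 * (X * b) ^ 4 * g ^ 3) * h1
  rw [key]
  simp only [map_add, map_smul, progression_f_twentyFive_pow_mul, progression_X_pow_five_mul_mul,
    u4]
  simp only [smul_eq_C_mul, map_ofNat, progression_one]
  ring

theorem m_zero_right (i : ℕ) : m i 0 = 0 := by simp [m]

theorem m_eq_zero_of_lt : ∀ j i, i < j → m i j = 0 := by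
  intro j
  induction j with
  | zero => simp
  | succ j ih =>
    intro i hi
    match i, j with
    | 0, _ => simp [m]
    | 1, j + 1 => simp [m]
    | 2, j + 2 => simp [m]
    | 3, j + 3 => simp [m]
    | 4, j + 4 => simp [m]
    | 5, j + 5 => simp [m]
    | i + 6, j + 1 =>
      rw [m, ih _ (by omega), ih _ (by omega), ih _ (by omega), ih _ (by omega), ih _ (by omega)]
      simp

/-- The recursion for `m`, valid in the first column as well. -/
theorem m_add_six (i j : ℕ) : m (i + 6) (j + 1) =
    25 * m (i + 5) j + 25 * m (i + 4) j + 15 * m (i + 3) j + 5 * m (i + 2) j + m (i + 1) j := by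
  cases j with
  | zero => simp [m]
  | succ j => rw [m]

theorem sum_m_eq {i n : ℕ} (h : i < n) (T : ℚ⟦X⟧) :
    ∑ j ∈ Finset.range n, (m i j : ℚ⟦X⟧) * T ^ j =
      ∑ j ∈ Finset.range (i + 1), (m i j : ℚ⟦X⟧) * T ^ j := by
  symm
  refine Finset.sum_subset (by simpa using h) fun j _ hj => ?_
  rw [m_eq_zero_of_lt j i (by simpa using hj)]
  simp

/-- The matrix `m` describes the action of `U_5` on the powers of `t`. -/
theorem progression_hauptmodul25_pow (i : ℕ) : progression 5 0 (hauptmodul25 ^ (i + 1)) =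
    ∑ j ∈ Finset.range (i + 2), (m (i + 1) j : ℚ⟦X⟧) * hauptmodul5 ^ j := by
  induction i using Nat.strong_induction_on with
  | h i ih =>
  have h1 := progression_hauptmodul25_pow_one
  have h2 := progression_hauptmodul25_pow_two
  have h3 := progression_hauptmodul25_pow_three
  have h4 := progression_hauptmodul25_pow_four
  have h5 := progression_hauptmodul25_pow_add_five 0
  simp only [zero_add, pow_zero, progression_one] at h5
  match i with
  | 0 => simp only [Nat.reduceAdd, h1, Finset.sum_range_succ, m]; push_cast; ring
  | 1 => simp only [Nat.reduceAdd, h2, h1, Finset.sum_range_succ, m]; push_cast; ring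
  | 2 => simp only [Nat.reduceAdd, h3, h2, h1, Finset.sum_range_succ, m]; push_cast; ring
  | 3 => simp only [Nat.reduceAdd, h4, h3, h2, h1, Finset.sum_range_succ, m]; push_cast; ring
  | 4 => simp only [Nat.reduceAdd, h5, h4, h3, h2, h1, Finset.sum_range_succ, m]; push_cast; ring
  | i + 5 =>
    rw [show i + 5 + 1 = i + 1 + 5 by ring, progression_hauptmodul25_pow_add_five,
      show i + 1 + 4 = i + 4 + 1 by ring, show i + 1 + 3 = i + 3 + 1 by ring,
      show i + 1 + 2 = i + 2 + 1 by ring, ih (i + 4) (by omega), ih (i + 3) (by omega),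
      ih (i + 2) (by omega), ih (i + 1) (by omega), ih i (by omega),
      ← sum_m_eq (show i + 3 + 1 < i + 6 by omega), ← sum_m_eq (show i + 2 + 1 < i + 6 by omega),
      ← sum_m_eq (show i + 1 + 1 < i + 6 by omega), ← sum_m_eq (show i + 1 < i + 6 by omega),
      show i + 5 + 2 = i + 6 + 1 by ring, Finset.sum_range_succ' _ (i + 6)]
    simp only [Finset.mul_sum, ← Finset.sum_add_distrib, show i + 1 + 5 = i + 6 by ring,
      m_add_six, m_zero_right]
    rw [Int.cast_zero, zero_mul, add_zero]
    refine Finset.sum_congr rfl fun j _ => ?_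
    push_cast
    ring

/-- The image under `U_5` of the eta quotient `q^(e - 5 i) f_5^c / f_1^e`. As `m_{e,j} = 0` for
`j ≤ i`, only positive powers of `q` occur. -/
theorem progression_monomial {e i R : ℕ} (c : ℕ) (hi : 5 * i < e) (hR : e ≤ i + R) :
    progression 5 0 (X ^ (e - 5 * i) * f 5 ^ c * (f 1)⁻¹ ^ e) = f 1 ^ c * (f 5)⁻¹ ^ e *
      ∑ r ∈ Finset.range R, (m e (i + 1 + r) : ℚ⟦X⟧) * X ^ (r + 1) *
        (f 5 * (f 1)⁻¹) ^ (6 * (i + 1 + r)) := by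
  apply mul_left_cancel₀ (pow_ne_zero i X_ne_zero)
  have h25 : f 25 ^ e * (f 25)⁻¹ ^ e = 1 := by
    rw [← mul_pow, f_mul_inv (by norm_num), one_pow]
  have key : X ^ (5 * i) * (X ^ (e - 5 * i) * f 5 ^ c * (f 1)⁻¹ ^ e) =
      f 5 ^ c * ((f 25)⁻¹ ^ e * hauptmodul25 ^ e) := by
    rw [hauptmodul25, mul_pow, mul_pow]
    have hX : (X : ℚ⟦X⟧) ^ (5 * i) * X ^ (e - 5 * i) = X ^ e := by
      rw [← pow_add]
      congr 1
      omega
    linear_combination f 5 ^ c * (f 1)⁻¹ ^ e * hX - f 5 ^ c * (f 1)⁻¹ ^ e * X ^ e * h25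
  rw [← progression_X_pow_five_mul_mul, key, progression_f_five_pow_mul,
    progression_f_twentyFive_inv_pow_mul]
  obtain ⟨e, rfl⟩ : ∃ d, e = d + 1 := ⟨e - 1, by omega⟩
  rw [progression_hauptmodul25_pow, ← sum_m_eq (show e + 1 < i + 1 + R by omega),
    Finset.sum_range_add, Finset.sum_eq_zero (s := Finset.range (i + 1)), zero_add]
  · simp only [Finset.mul_sum, hauptmodul5]
    refine Finset.sum_congr rfl fun r _ => ?_
    rw [pow_mul (f 5 * (f 1)⁻¹), mul_pow (f 5), mul_assoc X, mul_pow X]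
    ring
  · intro j hj
    rw [Finset.mem_range] at hj
    rw [m_eq_zero j _ (by omega), Int.cast_zero, zero_mul]

/-! ### The generating function of two-color partitions -/

theorem mk_card_restricted_mul_f {l : ℕ} (hl : l ≠ 0) :
    (mk fun n => ((Nat.Partition.restricted n (fun c => l ∣ c)).card : ℚ)) * f l = 1 := by
  have h1 := Nat.Partition.hasProd_powerSeriesMk_card_restricted ℚ (fun c => l ∣ c)
  have h2 : HasProd (fun m : ℕ => 1 - (X : ℚ⟦X⟧) ^ (l * (m + 1))) (f l) :=
    (multipliable_f (Nat.one_le_iff_ne_zero.mpr hl)).hasProd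
  rw [hasProd_multiples_iff hl fun n => 1 - (X : ℚ⟦X⟧) ^ n] at h2
  refine (h1.mul h2).unique ?_
  convert hasProd_one using 2 with n
  split_ifs
  · simp_rw [pow_mul]
    exact WithPiTopology.tsum_pow_mul_one_sub_of_constantCoeff_eq_zero (by simp)
  · exact one_mul 1

theorem mk_p1 {l : ℕ} (hl : l ≠ 0) : (mk fun n => (p1 l n : ℚ)) = (f 1)⁻¹ * (f l)⁻¹ := by
  have h {r : ℕ} (hr : r ≠ 0) :
      (f r)⁻¹ = mk fun n => ((Nat.Partition.restricted n (fun c => r ∣ c)).card : ℚ) := by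
    have := mk_card_restricted_mul_f hr
    linear_combination (-(f r)⁻¹) * this + (mk fun n =>
      ((Nat.Partition.restricted n (fun c => r ∣ c)).card : ℚ)) * f_mul_inv hr
  rw [h one_ne_zero, h hl]
  ext n
  simp [coeff_mul, p1, Nat.Partition.restricted]

/-! ### The recursion for the coefficient vectors -/

/-- The vector with entries `∑_{i ≥ 1} v_i m_{6i+a,i+r}`. The passage from `x_k` to `x_{k+1}` is the
case `a = 0` for odd `k` and `a = 1` for even `k`; that from `y_β` to `y_{β+1}` is the case
`a = 1`. -/
noncomputable def nextVector (a : ℕ) (v : ℕ → ℤ) (r : ℕ) : ℤ :=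
  ∑ᶠ i : ℕ+, v i * m (6 * i + a) (i + r)

theorem nextVector_eq_sum (a r : ℕ) {v : ℕ → ℤ} {N : ℕ} (hv : ∀ i, N < i → v i = 0) :
    nextVector a v r =
      ∑ i ∈ Finset.range N, v (i + 1) * m (6 * (i + 1) + a) (i + 1 + r) := by
  rw [nextVector, finsum_eq_sum_of_support_subset (s := (Finset.range N).image Nat.succPNat)]
  · rw [Finset.sum_image Nat.succPNat_injective.injOn]
    rfl
  · intro i hi
    simp only [Finset.coe_image, Finset.coe_range, Set.mem_image, Set.mem_Iio]
    refine ⟨i.natPred, ?_, i.succPNat_natPred⟩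
    by_contra hlt
    have h1 := i.natPred_add_one
    exact hi (by simp [hv i (by omega)])

theorem nextVector_eq_zero {a : ℕ} (ha : a ≤ 1) {v : ℕ → ℤ} {N : ℕ}
    (hv : ∀ i, N < i → v i = 0) (r : ℕ) (hr : 5 * N + 1 < r) : nextVector a v r = 0 := by
  rw [nextVector_eq_sum a r hv]
  refine Finset.sum_eq_zero fun i hi => ?_
  rw [Finset.mem_range] at hi
  rw [m_eq_zero_of_lt _ _ (by omega), mul_zero]

/-- Extracting one residue class modulo `5` replaces the coefficient vector `v` by
`nextVector a v`. The class is `4 - a` since multiplication by `q^(a+1)` moves it to `0`, and then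
`U_5` acts termwise by `progression_monomial`. -/
theorem progression_step {a : ℕ} (ha : a ≤ 1) {v : ℕ → ℤ} {N : ℕ} (hv : ∀ i, N < i → v i = 0) :
    progression 5 (4 - a) (∑ i ∈ Finset.range N, (v (i + 1) : ℚ⟦X⟧) * X ^ i * f 5 ^ (6 * i + 5)
        * (f 1)⁻¹ ^ (6 * i + 6 + a)) =
      ∑ r ∈ Finset.range (5 * N + 1), (nextVector a v (r + 1) : ℚ⟦X⟧) * X ^ r
        * f 5 ^ (6 * r + 6 - a) * (f 1)⁻¹ ^ (6 * r + 7) := by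
  apply mul_left_cancel₀ (X_ne_zero (R := ℚ))
  rw [← progression_X_pow_mul (show a + 1 + (4 - a) = 5 by omega) (by omega)]
  have hterm : ∀ i ∈ Finset.range N, progression 5 0 (X ^ (a + 1) * ((v (i + 1) : ℚ⟦X⟧) * X ^ i
      * f 5 ^ (6 * i + 5) * (f 1)⁻¹ ^ (6 * i + 6 + a))) =
      X * ∑ r ∈ Finset.range (5 * N + 1),
        ((v (i + 1) * m (6 * (i + 1) + a) (i + 1 + (r + 1)) : ℤ) : ℚ⟦X⟧) * X ^ r
        * f 5 ^ (6 * r + 6 - a) * (f 1)⁻¹ ^ (6 * r + 7) := by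
    intro i hi
    rw [Finset.mem_range] at hi
    have h := progression_monomial (e := 6 * i + 6 + a) (i := i + 1) (R := 5 * N + 1) (6 * i + 5)
      (by omega) (by omega)
    rw [show 6 * i + 6 + a - 5 * (i + 1) = i + (a + 1) by omega] at h
    rw [show X ^ (a + 1) * ((v (i + 1) : ℚ⟦X⟧) * X ^ i * f 5 ^ (6 * i + 5)
      * (f 1)⁻¹ ^ (6 * i + 6 + a)) = (v (i + 1) : ℚ) • (X ^ (i + (a + 1)) * f 5 ^ (6 * i + 5)
      * (f 1)⁻¹ ^ (6 * i + 6 + a)) by rw [smul_eq_C_mul, map_intCast]; ring, map_smul, h,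
      smul_eq_C_mul, map_intCast]
    simp only [Finset.mul_sum]
    refine Finset.sum_congr rfl fun r _ => ?_
    have h1 : f 1 ^ (6 * i + 5) * (f 1)⁻¹ ^ (6 * i + 5) = 1 := by
      rw [← mul_pow, f_mul_inv one_ne_zero, one_pow]
    have h5 : f 5 ^ (6 * i + 6 + a) * (f 5)⁻¹ ^ (6 * i + 6 + a) = 1 := by
      rw [← mul_pow, f_mul_inv (by norm_num), one_pow]
    rw [mul_pow (f 5), show (f 5) ^ (6 * (i + 1 + 1 + r)) =
        f 5 ^ (6 * i + 6 + a) * f 5 ^ (6 * r + 6 - a) by rw [← pow_add]; congr 1; omega,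
      show (f 1)⁻¹ ^ (6 * (i + 1 + 1 + r)) = (f 1)⁻¹ ^ (6 * i + 5) * (f 1)⁻¹ ^ (6 * r + 7) by
        rw [← pow_add]; congr 1; omega,
      show 6 * i + 6 + a = 6 * (i + 1) + a by ring, show i + 1 + 1 + r = i + 1 + (r + 1) by ring]
    rw [show 6 * i + 6 + a = 6 * (i + 1) + a by ring] at h5
    generalize f 5 ^ (6 * (i + 1) + a) = A at *
    generalize (f 5)⁻¹ ^ (6 * (i + 1) + a) = A' at *
    generalize f 1 ^ (6 * i + 5) = B at *
    generalize (f 1)⁻¹ ^ (6 * i + 5) = B' at *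
    push_cast
    linear_combination (v (i + 1) * m (6 * (i + 1) + a) (i + 1 + (r + 1)) * X ^ (r + 1)
      * f 5 ^ (6 * r + 6 - a) * (f 1)⁻¹ ^ (6 * r + 7)) * (A * A' * h1 + h5)
  rw [Finset.mul_sum, map_sum, Finset.sum_congr rfl hterm, ← Finset.mul_sum, Finset.sum_comm]
  congr 1
  refine Finset.sum_congr rfl fun r _ => ?_
  rw [nextVector_eq_sum a (r + 1) hv, Int.cast_sum, Finset.sum_mul, Finset.sum_mul, Finset.sum_mul]

theorem x_even (k : ℕ) : x (2 * k + 2) = nextVector 0 (x (2 * k + 1)) := by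
  funext i
  rw [x, if_pos (by simp), nextVector]
  rfl

theorem x_odd (k : ℕ) : x (2 * k + 3) = nextVector 1 (x (2 * k + 2)) := by
  funext i
  rw [x, if_neg (by simp [parity_simps]), nextVector]

theorem y_succ (k b : ℕ) : y k (b + 2) = nextVector 1 (y k (b + 1)) := by
  funext i
  rw [y, nextVector]
  simp only [add_comm]

/-! ### Partition generating functions along arithmetic progressions -/

/-- The generating function of `p(5^(2k+1) n + δ)` with `24 δ ≡ 1 (mod 5^(2k+1))`. -/
theorem exists_progression_inv_f_one (k : ℕ) : ∃ N, (∀ i, N < i → x (2 * k + 1) i = 0) ∧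
    progression (5 ^ (2 * k + 1)) ((19 * 5 ^ (2 * k + 1) + 1) / 24) (f 1)⁻¹ =
      ∑ i ∈ Finset.range N, (x (2 * k + 1) (i + 1) : ℚ⟦X⟧) * X ^ i * f 5 ^ (6 * i + 5)
        * (f 1)⁻¹ ^ (6 * i + 6) := by
  induction k with
  | zero =>
    refine ⟨1, fun i hi => ?_, ?_⟩
    · simp only [x]
      rw [if_neg (by omega)]
    · have h := progression_monomial (e := 1) (i := 0) (R := 1) 0 (by norm_num) (by norm_num)
      rw [mul_zero, Nat.sub_zero, pow_zero, mul_one,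
        progression_X_pow_mul (show 1 + 4 = 5 by norm_num) (by norm_num), pow_one, pow_zero,
        one_mul, pow_one] at h
      apply mul_left_cancel₀ (X_ne_zero (R := ℚ))
      simp only [mul_zero, zero_add, pow_one]
      norm_num only
      rw [h]
      have h5 := f_mul_inv (show 5 ≠ 0 by norm_num)
      have hm : m 1 1 = 5 := by simp [m]
      simp only [Finset.range_one, Finset.sum_singleton, x, zero_add, add_zero, hm, mul_one,
        if_true]
      push_cast
      linear_combination X * f 5 ^ 5 * (f 1)⁻¹ ^ 6 * 5 * h5
  | succ k ih =>
    obtain ⟨N, hN, h⟩ := ih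
    have hN' := nextVector_eq_zero zero_le_one hN
    have h1 := progression_step zero_le_one hN
    simp only [add_zero, Nat.sub_zero] at h1
    rw [← h, progression_progression, ← x_even] at h1
    rw [← x_even] at hN'
    have h2 := progression_step le_rfl hN'
    have h3 := nextVector_eq_zero le_rfl hN'
    rw [← x_odd] at h2 h3
    refine ⟨_, h3, ?_⟩
    have h4 := congrArg (progression 5 3) h1
    rw [progression_progression] at h4
    have hc : 5 ^ (2 * k + 1) * 5 * 3 + (5 ^ (2 * k + 1) * 4 + (19 * 5 ^ (2 * k + 1) + 1) / 24) =
        (19 * 5 ^ (2 * (k + 1) + 1) + 1) / 24 := by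
      have h24 := dvd_offset (k + 1) 0 (by omega)
      rw [show 2 * (k + 1) + 0 - 1 = 2 * k + 1 by omega,
        show 2 * (k + 1) - 1 = 2 * k + 1 by omega] at h24
      rw [show 5 ^ (2 * (k + 1) + 1) = 25 * 5 ^ (2 * k + 1) by ring]
      generalize 5 ^ (2 * k + 1) = u at *
      omega
    rw [hc, show 5 ^ (2 * k + 1) * 5 * 5 = 5 ^ (2 * (k + 1) + 1) by ring] at h4
    rw [h4]
    have hf : ∑ r ∈ Finset.range (5 * N + 1), (x (2 * k + 2) (r + 1) : ℚ⟦X⟧) * X ^ r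
        * f 5 ^ (6 * r + 6) * (f 1)⁻¹ ^ (6 * r + 7) = expand 5 (by norm_num) (f 1) *
        ∑ i ∈ Finset.range (5 * N + 1), (x (2 * k + 2) (i + 1) : ℚ⟦X⟧) * X ^ i
          * f 5 ^ (6 * i + 5) * (f 1)⁻¹ ^ (6 * i + 6 + 1) := by
      rw [← f_five, Finset.mul_sum]
      exact Finset.sum_congr rfl fun i _ => by ring
    rw [hf, progression_expand_mul _ (by norm_num), h2, Finset.mul_sum]
    refine Finset.sum_congr rfl fun i _ => ?_
    rw [show 6 * i + 6 - 1 = 6 * i + 5 by omega, show 2 * (k + 1) + 1 = 2 * k + 3 by ring]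
    linear_combination (x (2 * k + 3) (i + 1) : ℚ⟦X⟧) * X ^ i * f 5 ^ (6 * i + 5)
      * (f 1)⁻¹ ^ (6 * i + 6) * f_mul_inv one_ne_zero

/-- The theorem with `k + 1` in place of `k`, as an identity with a finite sum. -/
theorem exists_progression_p1 (k β : ℕ) : ∃ N, (∀ i, N < i → y (k + 1) (β + 1) i = 0) ∧
    progression (5 ^ (2 * k + 1 + β)) ((18 * 5 ^ (2 * k + 1 + β) + 5 ^ (2 * k + 1) + 1) / 24)
        (mk fun n => (p1 (5 ^ (2 * k + 1)) n : ℚ)) =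
      ∑ i ∈ Finset.range N, (y (k + 1) (β + 1) (i + 1) : ℚ⟦X⟧) * X ^ i * f 5 ^ (6 * i + 5)
        * (f 1)⁻¹ ^ (6 * i + 7) := by
  induction β with
  | zero =>
    obtain ⟨N, hN, h⟩ := exists_progression_inv_f_one k
    have hy : y (k + 1) (0 + 1) = x (2 * k + 1) := by
      funext i
      rw [zero_add, y]
      rfl
    rw [hy]
    refine ⟨N, hN, ?_⟩
    have hl : 5 ^ (2 * k + 1) ≠ 0 := by positivity
    have hinv := f_inv_mul hl one_ne_zero
    rw [mul_one] at hinv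
    rw [add_zero, mk_p1 hl, hinv, mul_comm (f 1)⁻¹,
      show 18 * 5 ^ (2 * k + 1) + 5 ^ (2 * k + 1) + 1 = 19 * 5 ^ (2 * k + 1) + 1 by ring,
      progression_expand_mul _ (by omega), h, Finset.mul_sum]
    exact Finset.sum_congr rfl fun i _ => by ring
  | succ β ih =>
    obtain ⟨N, hN, h⟩ := ih
    have h1 := progression_step le_rfl hN
    have h2 := nextVector_eq_zero le_rfl hN
    rw [← y_succ] at h1 h2
    refine ⟨_, h2, ?_⟩
    simp only [add_assoc, Nat.reduceAdd] at h h1 ⊢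
    rw [← h, progression_progression] at h1
    have hc : 5 ^ (2 * k + (1 + β)) * (4 - 1)
        + (18 * 5 ^ (2 * k + (1 + β)) + (5 ^ (2 * k + 1) + 1)) / 24 =
        (18 * 5 ^ (2 * k + (1 + (β + 1))) + (5 ^ (2 * k + 1) + 1)) / 24 := by
      rw [show 2 * k + (1 + (β + 1)) = 2 * k + (1 + β) + 1 by ring, pow_succ]
      omega
    rw [hc, show 5 ^ (2 * k + (1 + β)) * 5 = 5 ^ (2 * k + (1 + (β + 1))) by ring] at h1
    rw [h1]
    refine Finset.sum_congr rfl fun i _ => ?_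
    rw [show 6 * i + 6 - 1 = 6 * i + 5 by omega]

theorem f_pow_inv {r : ℕ} (hr : r ≠ 0) (n : ℕ) : (f r ^ n)⁻¹ = (f r)⁻¹ ^ n := by
  have h0 : constantCoeff (f r ^ n) ≠ 0 := by
    simp [constantCoeff_f (Nat.one_le_iff_ne_zero.mpr hr)]
  have h1 : f r ^ n * (f r)⁻¹ ^ n = 1 := by rw [← mul_pow, f_mul_inv hr, one_pow]
  exact ((PowerSeries.eq_inv_iff_mul_eq_one h0).mpr (by rw [mul_comm, h1])).symm

end TwoColor

theorem theorem3p1 (k β : ℕ) (hk : 1 ≤ k) :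
    HasSum
      (fun i : ℕ+ =>
        PowerSeries.C (TwoColor.y k (β + 1) i : ℚ) * PowerSeries.X ^ ((i : ℕ) - 1)
          * (TwoColor.f 5 ^ (6 * (i : ℕ) - 1) * (TwoColor.f 1 ^ (6 * (i : ℕ) + 1))⁻¹))
      (PowerSeries.mk fun n : ℕ =>
        (TwoColor.p1 (5 ^ (2 * k - 1))
          (5 ^ (2 * k + β - 1) * n
            + (18 * 5 ^ (2 * k + β - 1) + 5 ^ (2 * k - 1) + 1) / 24) : ℚ)) := by
  obtain ⟨k, rfl⟩ : ∃ j, k = j + 1 := ⟨k - 1, by omega⟩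
  obtain ⟨N, hN, h⟩ := TwoColor.exists_progression_p1 k β
  rw [show 2 * (k + 1) - 1 = 2 * k + 1 by omega,
    show 2 * (k + 1) + β - 1 = 2 * k + 1 + β by omega]
  have hl : (PowerSeries.mk fun n : ℕ => (TwoColor.p1 (5 ^ (2 * k + 1))
      (5 ^ (2 * k + 1 + β) * n
        + (18 * 5 ^ (2 * k + 1 + β) + 5 ^ (2 * k + 1) + 1) / 24) : ℚ)) =
      ∑ i ∈ (Finset.range N).image Nat.succPNat,
        PowerSeries.C (TwoColor.y (k + 1) (β + 1) i : ℚ) * PowerSeries.X ^ ((i : ℕ) - 1)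
          * (TwoColor.f 5 ^ (6 * (i : ℕ) - 1) * (TwoColor.f 1 ^ (6 * (i : ℕ) + 1))⁻¹) := by
    rw [Finset.sum_image Nat.succPNat_injective.injOn]
    refine Eq.trans ?_ (h.trans (Finset.sum_congr rfl fun i _ => ?_))
    · ext n
      simp
    · rw [TwoColor.f_pow_inv one_ne_zero, map_intCast, Nat.succPNat_coe, Nat.succ_eq_add_one,
        Nat.add_sub_cancel, show 6 * (i + 1) - 1 = 6 * i + 5 by omega,
        show 6 * (i + 1) + 1 = 6 * i + 7 by ring]
      ring
  rw [hl]
  refine hasSum_sum_of_ne_finset_zero fun i hi => ?_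
  have hiN : N < i := by
    by_contra hlt
    refine hi (Finset.mem_image.mpr ⟨i.natPred, ?_, i.succPNat_natPred⟩)
    have := i.natPred_add_one
    rw [Finset.mem_range]
    omega
  rw [hN i hiN]
  simp
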